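/- For a finite simple graph $G$, let $\mathrm{mad}(G)=\max_{H\subseteq G} 2|E(H)|/|V(H)|$ (the maximum is over all subgraphs $H$ with at least one vertex) be its maximum average degree, let $\Delta(G)$ be its maximum degree, and let $G^2$ be its square, the graph formed from $G$ by adding an edge between each pair of vertices at distance $2$ in $G$; let $\omega(G^2)$ denote the maximum size of a clique in $G^2$. Theorem. Fix a positive integer $D$. If a graph $G$ has $\mathrm{mad}(G)<4$ and $\Delta(G)\le D$, then $\omega(G^2)\le \frac52 D+532$. -/

import Mathlib

namespace SimpleGraph

/-- The square of a graph `G`: the graph on the same vertices obtained from `G` by adding an edge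
between each pair of vertices at distance exactly two in `G`. -/
def square {V : Type*} (G : SimpleGraph V) : SimpleGraph V where
  Adj u v := G.Adj u v ∨ G.dist u v = 2
  symm := ⟨fun u v h => by
    rcases h with h | h
    · exact Or.inl h.symm
    · exact Or.inr (by rw [SimpleGraph.dist_comm]; exact h)⟩
  loopless := ⟨fun u h => by
    rcases h with h | h
    · exact G.irrefl h
    · simp at h⟩

/-- The maximum average degree of a finite graph `G`: the maximum of `2|E(H)|/|V(H)|` over all
subgraphs `H` of `G`. The subgraph without vertices contributes `0 / 0 = 0`, which does not change
the maximum, as all values are nonnegative. -/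
noncomputable def mad {V : Type*} (G : SimpleGraph V) : ℝ :=
  ⨆ H : G.Subgraph, 2 * (H.edgeSet.ncard : ℝ) / (H.verts.ncard : ℝ)

end SimpleGraph

namespace SimpleGraph

open Finset

variable {V : Type*}

/-! Let `S` be a clique of `G.square`. Each vertex of `S` reaches the rest of `S` directly or
through a common neighbor, while sparsity bounds the total excess by `2 * #S`. Averaging first gives
`#S ≤ 3 * D + 5`.

If the bound fails, the set `H` of heavy vertices has at most 42 elements, and every vertex of `S \
H` has at least two neighbors in `H` (`fewNbrs_heavy_eq_empty`). All but `O(#H)` vertices of `S`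
then have exactly two, so `S` is essentially the edge set of a multigraph on `H` with degrees at
most `D`. An edge `uv` reaches only edges meeting it, plus about `D` others, so `#S ≤ deg u + deg v
- mult(uv) + D + O(#H)`. Summing over the neighbors of a vertex `u` of minimum degree contradicts
`#S > 5D/2 + 532` (`false_of_degree_constraints`). -/

lemma exists_common_neighbor_of_dist_eq_two {G : SimpleGraph V} {u v : V} (h : G.dist u v = 2) :
    ∃ w, G.Adj u w ∧ G.Adj w v := by
  have hr : G.Reachable u v := by
    by_contra hn
    rw [dist_eq_zero_of_not_reachable hn] at h
    omega
  obtain ⟨p, hp⟩ := hr.exists_walk_length_eq_dist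
  rw [h] at hp
  match p, hp with
  | .cons h₁ (.cons h₂ .nil), _ => exact ⟨_, h₁, h₂⟩

open Classical in
/-- The neighbors of `w` in the vertex set `A`. -/
noncomputable def nbrsIn (G : SimpleGraph V) (A : Finset V) (w : V) : Finset V :=
  {x ∈ A | G.Adj w x}

lemma mem_nbrsIn {G : SimpleGraph V} {A : Finset V} {w x : V} :
    x ∈ G.nbrsIn A w ↔ x ∈ A ∧ G.Adj w x := by
  simp [nbrsIn]

/-- The amount by which the number of neighbors of `w` in `S` exceeds two. -/
noncomputable def excess (G : SimpleGraph V) (S : Finset V) (w : V) : ℕ :=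
  #(G.nbrsIn S w) - 2

lemma sum_nbrsIn_comm (G : SimpleGraph V) (A M : Finset V) (f : V → ℕ) :
    ∑ z ∈ A, ∑ w ∈ G.nbrsIn M z, f w = ∑ w ∈ M, #(G.nbrsIn A w) * f w := by
  classical
  simp only [nbrsIn, sum_filter, card_filter, sum_mul]
  rw [sum_comm]
  refine sum_congr rfl fun w _ => sum_congr rfl fun z _ => ?_
  simp [G.adj_comm]

lemma sum_card_nbrsIn_comm (G : SimpleGraph V) (A M : Finset V) :
    ∑ z ∈ A, #(G.nbrsIn M z) = ∑ w ∈ M, #(G.nbrsIn A w) := by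
  simpa using G.sum_nbrsIn_comm A M fun _ => 1

variable [Fintype V]

/-! ### Edge counts from the maximum average degree -/

lemma sum_card_nbrsIn_self_le {G : SimpleGraph V} (hmad : G.mad < 4) (X : Finset V) :
    ∑ x ∈ X, #(G.nbrsIn X x) ≤ 4 * #X := by
  classical
  rcases X.eq_empty_or_nonempty with rfl | hX
  · simp
  let H : G.Subgraph := (⊤ : G.Subgraph).induce (X : Set V)
  have h1 : 2 * (H.edgeSet.ncard : ℝ) / (H.verts.ncard : ℝ) < 4 := by
    refine lt_of_le_of_lt ?_ hmad
    exact le_ciSup (f := fun H : G.Subgraph => 2 * (H.edgeSet.ncard : ℝ) / (H.verts.ncard : ℝ))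
      (Set.finite_range _).bddAbove H
  have h2 : H.verts.ncard = #X := by simp [H, Set.ncard_coe_finset]
  have h3 : 2 * H.edgeSet.ncard = ∑ x ∈ X, #(G.nbrsIn X x) := by
    have h4 := H.spanningCoe.sum_degrees_eq_twice_card_edges
    have h5 : H.edgeSet.ncard = #H.spanningCoe.edgeFinset := by
      rw [← Set.ncard_coe_finset, coe_edgeFinset]
      rfl
    rw [h5, ← h4, ← sum_subset (subset_univ X)]
    · refine sum_congr rfl fun x hx => ?_
      rw [← card_neighborFinset_eq_degree]
      congr 1
      ext y
      simp [mem_nbrsIn, H, hx]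
    · intro x _ hx
      rw [← card_neighborFinset_eq_degree, card_eq_zero]
      ext y
      simp [H, hx]
  have hpos : (0 : ℝ) < #X := by exact_mod_cast hX.card_pos
  rw [h2, div_lt_iff₀ hpos] at h1
  have h6 : 2 * H.edgeSet.ncard < 4 * #X := by exact_mod_cast h1
  omega

lemma sum_card_nbrsIn_le {G : SimpleGraph V} (hmad : G.mad < 4) (A W : Finset V) :
    ∑ w ∈ W, #(G.nbrsIn A w) ≤ 2 * #A + 2 * #W := by
  classical
  have key : ∀ A W : Finset V, ∑ w ∈ W, #(G.nbrsIn A w) =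
      ∑ w : V, ∑ x : V, if w ∈ W ∧ x ∈ A ∧ G.Adj w x then 1 else 0 := by
    intro A W
    simp only [nbrsIn, card_filter]
    rw [← sum_subset (subset_univ W)]
    · refine sum_congr rfl fun w hw => ?_
      rw [← sum_subset (subset_univ A)]
      · simp +contextual [hw]
      · simp +contextual
    · simp +contextual
  -- `A` and `W` may overlap: each ordered adjacent pair counted twice on the left lies in both `A ∪
  -- W` and `A ∩ W`.
  have h1 : ∑ w ∈ W, #(G.nbrsIn A w) + ∑ w ∈ A, #(G.nbrsIn W w) ≤
      ∑ w ∈ A ∪ W, #(G.nbrsIn (A ∪ W) w) + ∑ w ∈ A ∩ W, #(G.nbrsIn (A ∩ W) w) := by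
    simp only [key, ← sum_add_distrib]
    refine sum_le_sum fun w _ => sum_le_sum fun x _ => ?_
    by_cases h1 : w ∈ W <;> by_cases h2 : w ∈ A <;> by_cases h3 : x ∈ W <;> by_cases h4 : x ∈ A <;>
      by_cases h5 : G.Adj w x <;> simp [h1, h2, h3, h4, h5]
  have h2 := G.sum_card_nbrsIn_comm A W
  have h3 := sum_card_nbrsIn_self_le hmad (A ∪ W)
  have h4 := sum_card_nbrsIn_self_le hmad (A ∩ W)
  have h5 := card_union_add_card_inter A W
  omega

lemma sum_excess_le {G : SimpleGraph V} (hmad : G.mad < 4) (S : Finset V) :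
    ∑ w, G.excess S w ≤ 2 * #S := by
  classical
  have h := sum_card_nbrsIn_le hmad S {w | 2 ≤ #(G.nbrsIn S w)}
  have h1 : ∑ w, G.excess S w = ∑ w with 2 ≤ #(G.nbrsIn S w), G.excess S w := by
    symm
    refine sum_subset (subset_univ _) fun w _ hw => ?_
    simp at hw
    simp only [excess]
    omega
  have h2 : ∑ w with 2 ≤ #(G.nbrsIn S w), #(G.nbrsIn S w) =
      ∑ w with 2 ≤ #(G.nbrsIn S w), G.excess S w + ∑ w with 2 ≤ #(G.nbrsIn S w), 2 := by
    rw [← sum_add_distrib]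
    refine sum_congr rfl fun w hw => ?_
    simp at hw
    simp only [excess]
    omega
  simp only [sum_const, smul_eq_mul] at h2
  omega

/-- Layer-cake argument: apply `sum_card_nbrsIn_le` to each of the `t` superlevel sets of `f` and
add up. -/
lemma sum_card_nbrsIn_mul_le {G : SimpleGraph V} (hmad : G.mad < 4) (A M : Finset V) (f : V → ℕ)
    (t : ℕ) (hf : ∀ w ∈ M, f w ≤ t) :
    ∑ w ∈ M, #(G.nbrsIn A w) * f w ≤ 2 * t * #A + 2 * ∑ w ∈ M, f w := by
  classical
  have hlayer : ∀ w ∈ M, f w = ∑ i ∈ range t, if i < f w then 1 else 0 := by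
    intro w hw
    rw [← card_filter]
    have : {i ∈ range t | i < f w} = range (f w) := by
      ext i
      have := hf w hw
      simp only [mem_filter, mem_range]
      omega
    rw [this, card_range]
  have h1 : ∑ w ∈ M, #(G.nbrsIn A w) * f w =
      ∑ i ∈ range t, ∑ w ∈ M with i < f w, #(G.nbrsIn A w) := by
    simp only [sum_filter]
    rw [sum_comm]
    refine sum_congr rfl fun w hw => ?_
    conv_lhs => rw [hlayer w hw, mul_sum]
    simp
  have h2 : ∑ w ∈ M, f w = ∑ i ∈ range t, #{w ∈ M | i < f w} := by
    simp only [card_filter]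
    rw [sum_comm]
    exact sum_congr rfl hlayer
  rw [h1, h2, mul_sum]
  calc _ ≤ ∑ i ∈ range t, (2 * #A + 2 * #{w ∈ M | i < f w}) :=
        sum_le_sum fun i _ => sum_card_nbrsIn_le hmad A _
    _ = _ := by
        rw [sum_add_distrib]
        simp only [sum_const, card_range, smul_eq_mul]
        ring

/-! ### What a single clique vertex reaches -/

/-- A neighbor of `z` outside `H` leads to at most one vertex of `S` other than `z`, plus its
excess. Neighbors in `H` are kept as an exact union, so that overlaps can be exploited later. -/
lemma card_add_card_nbrsIn_le [DecidableEq V] {G : SimpleGraph V} {D : ℕ} {S : Finset V}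
    (hdeg : ∀ z, #(G.nbrsIn univ z) ≤ D) (hS : G.square.IsClique (S : Set V)) (H : Finset V)
    {z : V} (hz : z ∈ S) :
    #S + #(G.nbrsIn H z) ≤ D + 3 + G.excess S z + #((G.nbrsIn H z).biUnion (G.nbrsIn S)) +
      ∑ w ∈ G.nbrsIn Hᶜ z, G.excess S w := by
  have hsub : S ⊆ ({z} ∪ G.nbrsIn S z) ∪ ((G.nbrsIn H z).biUnion (G.nbrsIn S) ∪
      (G.nbrsIn Hᶜ z).biUnion fun w => (G.nbrsIn S w).erase z) := by
    intro x hx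
    by_cases hxz : x = z
    · simp [hxz]
    simp only [mem_union, mem_singleton, mem_biUnion, mem_nbrsIn, mem_erase, mem_compl]
    rcases hS hz hx (Ne.symm hxz) with h | h
    · exact Or.inl (Or.inr ⟨hx, h⟩)
    · obtain ⟨w, h1, h2⟩ := exists_common_neighbor_of_dist_eq_two h
      by_cases hw : w ∈ H
      · exact Or.inr (Or.inl ⟨w, ⟨hw, h1⟩, hx, h2⟩)
      · exact Or.inr (Or.inr ⟨w, ⟨hw, h1⟩, hxz, hx, h2⟩)
  have h1 := card_le_card hsub
  have h2 := card_union_le ({z} ∪ G.nbrsIn S z) ((G.nbrsIn H z).biUnion (G.nbrsIn S) ∪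
      (G.nbrsIn Hᶜ z).biUnion fun w => (G.nbrsIn S w).erase z)
  have h3 := card_union_le {z} (G.nbrsIn S z)
  have h4 := card_union_le ((G.nbrsIn H z).biUnion (G.nbrsIn S))
    ((G.nbrsIn Hᶜ z).biUnion fun w => (G.nbrsIn S w).erase z)
  have h5 : #((G.nbrsIn Hᶜ z).biUnion fun w => (G.nbrsIn S w).erase z) ≤
      #(G.nbrsIn Hᶜ z) + ∑ w ∈ G.nbrsIn Hᶜ z, G.excess S w := by
    refine card_biUnion_le.trans ?_
    rw [card_eq_sum_ones, ← sum_add_distrib]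
    refine sum_le_sum fun w hw => ?_
    rw [card_erase_of_mem (mem_nbrsIn.2 ⟨hz, (mem_nbrsIn.1 hw).2.symm⟩)]
    simp only [excess]
    omega
  have h6 : #(G.nbrsIn H z) + #(G.nbrsIn Hᶜ z) ≤ D := by
    refine le_trans (le_of_eq ?_) (hdeg z)
    rw [← card_union_of_disjoint ?_]
    · congr 1
      ext x
      simp only [mem_union, mem_nbrsIn, mem_compl, mem_univ]
      tauto
    · rw [Finset.disjoint_left]
      intro x hx hx'
      simp only [mem_nbrsIn, mem_compl] at hx hx'
      exact hx'.1 hx.1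
  have h7 : #(G.nbrsIn S z) ≤ G.excess S z + 2 := by simp only [excess]; omega
  simp only [card_singleton] at h3
  omega

lemma card_nbrsIn_le {G : SimpleGraph V} {D : ℕ} (hdeg : ∀ z, #(G.nbrsIn univ z) ≤ D)
    (S : Finset V) (w : V) : #(G.nbrsIn S w) ≤ D :=
  (card_le_card fun _ hx => mem_nbrsIn.2 ⟨mem_univ _, (mem_nbrsIn.1 hx).2⟩).trans (hdeg w)

/-- Average the preceding bound with `H = ∅` over `z ∈ S`: each excess is counted at most `D` times,
and the total excess is at most `2 * #S`. -/
lemma card_le_three_mul {G : SimpleGraph V} {D : ℕ} {S : Finset V} (hmad : G.mad < 4)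
    (hdeg : ∀ z, #(G.nbrsIn univ z) ≤ D) (hS : G.square.IsClique (S : Set V)) :
    #S ≤ 3 * D + 5 := by
  classical
  rcases S.eq_empty_or_nonempty with rfl | hne
  · simp
  have h1 : ∑ _z ∈ S, #S ≤
      ∑ z ∈ S, (D + 3 + G.excess S z + ∑ w ∈ G.nbrsIn univ z, G.excess S w) := by
    refine sum_le_sum fun z hz => ?_
    have h := card_add_card_nbrsIn_le hdeg hS ∅ hz
    simpa [nbrsIn] using h
  have h2 := sum_excess_le hmad S
  have h3 : ∑ z ∈ S, G.excess S z ≤ ∑ w, G.excess S w := sum_le_sum_of_subset (subset_univ S)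
  have h4 : ∑ w, #(G.nbrsIn S w) * G.excess S w ≤ D * (2 * #S) := by
    refine le_trans ?_ (Nat.mul_le_mul_left D h2)
    rw [mul_sum]
    exact sum_le_sum fun w _ => Nat.mul_le_mul_right _ (card_nbrsIn_le hdeg S w)
  rw [sum_add_distrib, sum_add_distrib, sum_nbrsIn_comm, sum_const, sum_const] at h1
  simp only [smul_eq_mul] at h1
  have hpos := hne.card_pos
  by_contra hcon
  nlinarith

/-! ### Heavy vertices -/

/-- The vertices of `S` outside `H` with at most one neighbor in `H`. -/
noncomputable def fewNbrs [DecidableEq V] (G : SimpleGraph V) (S H : Finset V) : Finset V :=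
  {z ∈ S \ H | #(G.nbrsIn H z) ≤ 1}

/-- Vertices of `S \ H` with two neighbors in `H` already use up nearly the whole excess budget `2 *
#S` inside `H`. -/
lemma sum_excess_compl_le [DecidableEq V] {G : SimpleGraph V} (hmad : G.mad < 4)
    (S H : Finset V) :
    ∑ w ∈ Hᶜ, G.excess S w ≤ 2 * #(fewNbrs G S H) + 4 * #H := by
  have h1 := sum_excess_le hmad S
  rw [← sum_add_sum_compl H] at h1
  have h2 : ∑ w ∈ H, #(G.nbrsIn S w) ≤ ∑ w ∈ H, G.excess S w + 2 * #H := by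
    rw [mul_comm, ← smul_eq_mul, ← sum_const, ← sum_add_distrib]
    refine sum_le_sum fun w _ => ?_
    simp only [excess]
    omega
  rw [← sum_card_nbrsIn_comm] at h2
  have h3 : 2 * #((S \ H) \ fewNbrs G S H) ≤ ∑ z ∈ S, #(G.nbrsIn H z) := by
    rw [mul_comm, ← smul_eq_mul, ← sum_const]
    refine le_trans (sum_le_sum fun z hz => ?_)
      (sum_le_sum_of_subset (sdiff_subset.trans sdiff_subset))
    simp only [fewNbrs, mem_sdiff, mem_filter, not_and, not_le] at hz
    exact hz.2 hz.1
  have h4 := le_card_sdiff (fewNbrs G S H) (S \ H)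
  have h5 := le_card_sdiff H S
  omega

lemma card_le_excess_of_mem_fewNbrs [DecidableEq V] {G : SimpleGraph V} {D : ℕ} {S H : Finset V}
    (hdeg : ∀ z, #(G.nbrsIn univ z) ≤ D) (hS : G.square.IsClique (S : Set V)) {z : V}
    (hz : z ∈ fewNbrs G S H) :
    #S ≤ 2 * D + 3 + G.excess S z + ∑ w ∈ G.nbrsIn Hᶜ z, G.excess S w := by
  simp only [fewNbrs, mem_filter, mem_sdiff] at hz
  have h := card_add_card_nbrsIn_le hdeg hS H hz.1.1
  have h1 : #((G.nbrsIn H z).biUnion (G.nbrsIn S)) ≤ #(G.nbrsIn H z) * D :=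
    card_biUnion_le_card_mul _ _ _ fun w _ => card_nbrsIn_le hdeg S w
  have h2 : #(G.nbrsIn H z) * D ≤ 1 * D := Nat.mul_le_mul_right D hz.2
  omega

lemma excess_add_sum_le [DecidableEq V] (G : SimpleGraph V) (S : Finset V) {H : Finset V} {z : V}
    (hz : z ∉ H) :
    G.excess S z + ∑ w ∈ G.nbrsIn Hᶜ z, G.excess S w ≤ ∑ w ∈ Hᶜ, G.excess S w := by
  have h : z ∉ G.nbrsIn Hᶜ z := by simp [mem_nbrsIn]
  rw [← sum_insert h]
  refine sum_le_sum_of_subset fun w hw => ?_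
  rcases mem_insert.1 hw with rfl | hw
  · simpa using hz
  · exact (mem_nbrsIn.1 hw).1

/-- The vertices with many neighbors in `S`, compared to `D`. -/
noncomputable def heavy (G : SimpleGraph V) (S : Finset V) (D : ℕ) : Finset V :=
  {w | D ≤ 7 * G.excess S w}

lemma card_heavy_le {G : SimpleGraph V} {D : ℕ} {S : Finset V} (hmad : G.mad < 4)
    (hD : 1055 ≤ D) (hs : #S ≤ 3 * D + 5) : #(G.heavy S D) ≤ 42 := by
  have h1 := sum_excess_le hmad S
  have h2 : #(G.heavy S D) * D ≤ 7 * ∑ w, G.excess S w := by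
    rw [← smul_eq_mul, ← sum_const, mul_sum]
    refine le_trans (sum_le_sum fun w hw => ?_) (sum_le_sum_of_subset (subset_univ _))
    simpa [heavy] using hw
  by_contra hcon
  have h3 : 43 * D ≤ #(G.heavy S D) * D := Nat.mul_le_mul_right D (by omega)
  omega

/-- An exceptional vertex needs about `D/2 - D/7` excess from light neighbors, whereas sparsity
supplies about `2D/7` per vertex plus `4 * #S` overall. The surplus `D/14` is why the threshold is
`D/7`; it leaves at most 168 exceptions. Then the total light excess is at most `2 * 168 + 4 * 42`,
too little for even one. -/
lemma fewNbrs_heavy_eq_empty [DecidableEq V] {G : SimpleGraph V} {D : ℕ} {S : Finset V}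
    (hmad : G.mad < 4) (hdeg : ∀ z, #(G.nbrsIn univ z) ≤ D)
    (hS : G.square.IsClique (S : Set V)) (hD : 1055 ≤ D) (hs : 5 * D + 1064 < 2 * #S) :
    fewNbrs G S (G.heavy S D) = ∅ := by
  have hs' := card_le_three_mul hmad hdeg hS
  set H := G.heavy S D with hH
  set A := fewNbrs G S H with hA
  have hk : #H ≤ 42 := card_heavy_le hmad hD hs'
  have hlight : ∀ w ∉ H, G.excess S w ≤ D / 7 := by
    intro w hw
    simp only [hH, heavy, mem_filter, mem_univ, true_and] at hw
    omega
  have h1 : #A * (#S - 2 * D - 3 - D / 7) ≤ ∑ z ∈ A, ∑ w ∈ G.nbrsIn Hᶜ z, G.excess S w := by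
    rw [← smul_eq_mul, ← sum_const]
    refine sum_le_sum fun z hz => ?_
    have h := card_le_excess_of_mem_fewNbrs hdeg hS hz
    have hzH : z ∉ H := by
      simp only [hA, fewNbrs, mem_filter, mem_sdiff] at hz
      exact hz.1.2
    have := hlight z hzH
    omega
  rw [sum_nbrsIn_comm] at h1
  have h2 := sum_card_nbrsIn_mul_le hmad A Hᶜ (G.excess S) (D / 7)
    fun w hw => hlight w (by simpa using hw)
  have h3 : ∑ w ∈ Hᶜ, G.excess S w ≤ 2 * #S :=
    (sum_le_sum_of_subset (subset_univ _)).trans (sum_excess_le hmad S)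
  have hcard : #A ≤ 168 := by
    by_contra hcon
    have h4 : 2 * (D / 7) + D / 14 + 527 ≤ #S - 2 * D - 3 - D / 7 := by omega
    have h5 : #A * (2 * (D / 7) + D / 14 + 527) ≤ 2 * (D / 7) * #A + 4 * #S := by
      refine (Nat.mul_le_mul_left _ h4).trans ?_
      omega
    have h6 : #A * (D / 14 + 527) ≤ 4 * #S := by nlinarith
    have h7 : 169 * (D / 14 + 527) ≤ #A * (D / 14 + 527) := Nat.mul_le_mul_right _ (by omega)
    omega
  refine eq_empty_of_forall_notMem fun z hz => ?_
  have h4 := card_le_excess_of_mem_fewNbrs hdeg hS hz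
  have hzH : z ∉ H := by
    simp only [hA, fewNbrs, mem_filter, mem_sdiff] at hz
    exact hz.1.2
  have h5 := excess_add_sum_le G S hzH
  have h6 := sum_excess_compl_le hmad S H
  rw [← hA] at h6
  omega

lemma card_filter_three_le [DecidableEq V] {G : SimpleGraph V} (hmad : G.mad < 4)
    (S H : Finset V) : #{z ∈ S | 3 ≤ #(G.nbrsIn H z)} ≤ 2 * #H := by
  have h1 := sum_card_nbrsIn_le hmad H {z ∈ S | 3 ≤ #(G.nbrsIn H z)}
  have h2 : #{z ∈ S | 3 ≤ #(G.nbrsIn H z)} * 3 ≤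
      ∑ z ∈ S with 3 ≤ #(G.nbrsIn H z), #(G.nbrsIn H z) := by
    rw [← smul_eq_mul, ← sum_const]
    exact sum_le_sum fun z hz => (mem_filter.1 hz).2
  omega

/-- The arithmetic obstruction: `k` heavy vertices with degree sum at most `2 * s + 2 * k`, the
smallest of the degrees being `d`, and `h` of these vertices joined to the smallest one, with
degree sum `e`. -/
lemma false_of_degree_constraints {D s k h d e : ℕ} (hD : 1055 ≤ D)
    (hs : 5 * D + 1064 < 2 * s) (hs' : s ≤ 3 * D + 5) (hk : k ≤ 42) (hkD : 2 * s ≤ k * D + 2 * k)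
    (hhk : h + 1 ≤ k) (hd : 3 * k < d) (hdD : d ≤ D)
    (hsum : h * s + d ≤ h * d + e + h * (D + 4 * k + 1) + 3 * k)
    (heD : e ≤ h * D) (he : e + (k - h) * d ≤ 2 * s + 2 * k)
    (hkd : k * d ≤ 2 * s + 2 * k) : False := by
  have hh : 0 < h := by
    rcases Nat.eq_zero_or_pos h with rfl | hh
    · omega
    · exact hh
  -- Inserting `e ≤ h * D` in `hsum` forces `d` above roughly `s - 2 * D`, hence above `D / 2`.
  have hhalf : D < 2 * d := by
    by_contra hcon
    have h1 : h * d ≤ h * (s - 2 * D - 4 * k - 1 - 3 * k) := Nat.mul_le_mul_left h (by omega)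
    have h2 : h * (s - 2 * D - 4 * k - 1 - 3 * k) + h * (2 * D + 4 * k + 1 + 3 * k) = h * s := by
      rw [← mul_add]
      congr 1
      omega
    have h3 : 3 * k ≤ h * (3 * k) := Nat.le_mul_of_pos_left _ hh
    nlinarith
  -- Degrees above `D / 2` with sum about `2 * s`, at most about `6 * D`, leave room for few heavy
  -- vertices.
  have hk12 : k ≤ 12 := by
    by_contra hcon
    have h1 : k * D + k ≤ k * (2 * d) := by nlinarith
    nlinarith
  have hk6 : 6 ≤ k := by
    by_contra hcon
    have h1 : k * D ≤ 5 * D := Nat.mul_le_mul_right D (by omega)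
    omega
  interval_cases k <;> have hh' : h ≤ 11 := by omega
  -- Each case is linear. For `k = 6`, `h = 5` the main terms give `3s ≤ 3d + 5D` and `3d ≤ s`, that
  -- is, exactly `s ≤ 5D/2`.
  all_goals interval_cases h <;> omega

/-! ### The multigraph on the heavy vertices -/

lemma card_clique_square_le {G : SimpleGraph V} {D : ℕ} {S : Finset V} (hmad : G.mad < 4)
    (hdeg : ∀ z, #(G.nbrsIn univ z) ≤ D) (hS : G.square.IsClique (S : Set V)) :
    2 * #S ≤ 5 * D + 1064 := by
  classical
  by_contra! hs
  have hs' := card_le_three_mul hmad hdeg hS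
  have hD : 1055 ≤ D := by omega
  have hfew := fewNbrs_heavy_eq_empty hmad hdeg hS hD hs
  set H := G.heavy S D with hH
  have hk : #H ≤ 42 := card_heavy_le hmad hD hs'
  have hlight := sum_excess_compl_le hmad S H
  rw [hfew, card_empty] at hlight
  have htwo : ∀ z ∈ S, z ∉ H → 2 ≤ #(G.nbrsIn H z) := by
    intro z hz hzH
    by_contra hcon
    have : z ∈ fewNbrs G S H := by
      simp only [fewNbrs, mem_filter, mem_sdiff]
      exact ⟨⟨hz, hzH⟩, by omega⟩
    simp [hfew] at this
  have hsumH := sum_card_nbrsIn_le hmad S H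
  have hsumH' : 2 * #(S \ H) ≤ ∑ w ∈ H, #(G.nbrsIn S w) := by
    rw [← sum_card_nbrsIn_comm, mul_comm, ← smul_eq_mul, ← sum_const]
    refine le_trans (sum_le_sum fun z hz => ?_) (sum_le_sum_of_subset sdiff_subset)
    exact htwo z (mem_sdiff.1 hz).1 (mem_sdiff.1 hz).2
  have hsd := le_card_sdiff H S
  have hHD : ∑ w ∈ H, #(G.nbrsIn S w) ≤ #H * D :=
    sum_le_card_nsmul _ _ _ fun w _ => card_nbrsIn_le hdeg S w
  have hne : H.Nonempty := by
    rw [nonempty_iff_ne_empty]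
    intro h
    rw [h, sum_empty] at hsumH'
    rw [h, card_empty] at hsd
    omega
  obtain ⟨u, hu, humin⟩ := H.exists_min_image (fun w => #(G.nbrsIn S w)) hne
  -- The neighbors of `u` in the multigraph; the witness `z` is an edge `uv`, to which the clique
  -- bound is applied.
  set N : Finset V := {v ∈ H.erase u | ∃ z ∈ S \ H, G.nbrsIn H z = {u, v}} with hN
  have hNH : N ⊆ H.erase u := filter_subset _ _
  have hpair : ∀ v ∈ N, #S + #(G.nbrsIn S u ∩ G.nbrsIn S v) ≤
      #(G.nbrsIn S u) + #(G.nbrsIn S v) + (D + 4 * #H + 1) := by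
    intro v hv
    obtain ⟨hv, z, hz, hzuv⟩ := mem_filter.1 hv
    have hvu : u ≠ v := (ne_of_mem_erase hv).symm
    have h1 := card_add_card_nbrsIn_le hdeg hS H (mem_sdiff.1 hz).1
    have h2 := excess_add_sum_le G S (mem_sdiff.1 hz).2
    have h3 := card_union_add_card_inter (G.nbrsIn S u) (G.nbrsIn S v)
    rw [hzuv, card_pair hvu, biUnion_insert, singleton_biUnion] at h1
    omega
  -- The error `3 * #H` accounts for vertices of `H` itself and the at most `2 * #H` vertices of `S`
  -- with three or more heavy neighbors.
  have hcover : #(G.nbrsIn S u) ≤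
      ∑ v ∈ N, #(G.nbrsIn S u ∩ G.nbrsIn S v) + 3 * #H := by
    have hsub : G.nbrsIn S u ⊆ (N.biUnion fun v => G.nbrsIn S u ∩ G.nbrsIn S v) ∪
        (H ∪ ({z ∈ S | 3 ≤ #(G.nbrsIn H z)} : Finset V)) := by
      intro z hz
      have hz' := mem_nbrsIn.1 hz
      simp only [mem_union, mem_biUnion, mem_inter, mem_filter]
      by_cases hzH : z ∈ H
      · exact Or.inr (Or.inl hzH)
      by_cases h3 : 3 ≤ #(G.nbrsIn H z)
      · exact Or.inr (Or.inr ⟨hz'.1, h3⟩)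
      have h2 : #(G.nbrsIn H z) = 2 := by
        have := htwo z hz'.1 hzH
        omega
      have huz : u ∈ G.nbrsIn H z := mem_nbrsIn.2 ⟨hu, hz'.2.symm⟩
      have h4 : #((G.nbrsIn H z).erase u) = 1 := by rw [card_erase_of_mem huz, h2]
      obtain ⟨v, hv⟩ := card_eq_one.1 h4
      have hvmem : v ∈ (G.nbrsIn H z).erase u := by simp [hv]
      have hvH := mem_nbrsIn.1 (mem_of_mem_erase hvmem)
      refine Or.inl ⟨v, ?_, hz, mem_nbrsIn.2 ⟨hz'.1, hvH.2.symm⟩⟩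
      refine mem_filter.2 ⟨mem_erase.2 ⟨ne_of_mem_erase hvmem, hvH.1⟩, z,
        mem_sdiff.2 ⟨hz'.1, hzH⟩, ?_⟩
      rw [← insert_erase huz, hv]
    have h1 := card_le_card hsub
    have h2 := card_union_le (N.biUnion fun v => G.nbrsIn S u ∩ G.nbrsIn S v)
      (H ∪ ({z ∈ S | 3 ≤ #(G.nbrsIn H z)} : Finset V))
    have h3 := card_union_le H ({z ∈ S | 3 ≤ #(G.nbrsIn H z)} : Finset V)
    have h4 : #(N.biUnion fun v => G.nbrsIn S u ∩ G.nbrsIn S v) ≤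
      ∑ v ∈ N, #(G.nbrsIn S u ∩ G.nbrsIn S v) := card_biUnion_le
    have h5 := card_filter_three_le hmad S H
    omega
  have hsum := sum_le_sum hpair
  simp only [sum_add_distrib, sum_const, smul_eq_mul] at hsum
  have hNcard : #N + 1 ≤ #H := by
    have h1 := card_le_card hNH
    rw [card_erase_of_mem hu] at h1
    have := hne.card_pos
    omega
  have hrest : ∑ v ∈ N, #(G.nbrsIn S v) + (#H - #N) * #(G.nbrsIn S u) ≤
      ∑ w ∈ H, #(G.nbrsIn S w) := by
    have hNH' : N ⊆ H := hNH.trans (erase_subset _ _)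
    rw [← sum_sdiff hNH', add_comm, ← card_sdiff_of_subset hNH', ← smul_eq_mul, ← sum_const]
    exact Nat.add_le_add_right (sum_le_sum fun w hw => humin w (mem_sdiff.1 hw).1) _
  have hmin : #H * #(G.nbrsIn S u) ≤ ∑ w ∈ H, #(G.nbrsIn S w) :=
    card_nsmul_le_sum _ _ _ humin
  have hdu : D ≤ 7 * (#(G.nbrsIn S u) - 2) := by
    exact (mem_filter.1 hu).2
  refine false_of_degree_constraints (D := D) (s := #S) (k := #H) (h := #N)
    (d := #(G.nbrsIn S u)) (e := ∑ v ∈ N, #(G.nbrsIn S v)) hD hs hs' hk ?_ hNcard ?_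
    (card_nbrsIn_le hdeg S u) ?_ ?_ ?_ ?_
  · omega
  · omega
  · linarith
  · exact sum_le_card_nsmul _ _ _ fun w _ => card_nbrsIn_le hdeg S w
  · omega
  · omega

end SimpleGraph

theorem theorem2 {V : Type*} [Fintype V] (G : SimpleGraph V) [DecidableRel G.Adj]
    (D : ℕ) (hD : 0 < D) (hmad : G.mad < 4) (hdeg : G.maxDegree ≤ D) :
    (G.square.cliqueNum : ℝ) ≤ 5 / 2 * (D : ℝ) + 532 := by
  obtain ⟨S, hS⟩ := G.square.exists_isNClique_cliqueNum
  have hdeg' : ∀ z, (G.nbrsIn Finset.univ z).card ≤ D := by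
    intro z
    refine le_trans (le_of_eq ?_) ((G.degree_le_maxDegree z).trans hdeg)
    rw [← SimpleGraph.card_neighborFinset_eq_degree]
    congr 1
    ext x
    simp [SimpleGraph.mem_nbrsIn]
  have h := SimpleGraph.card_clique_square_le hmad hdeg' hS.isClique
  rw [hS.card_eq] at h
  have h' : 2 * (G.square.cliqueNum : ℝ) ≤ 5 * (D : ℝ) + 1064 := by exact_mod_cast h
  linarith
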